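/- Let $\mu$ be a Borel probability measure on $\mathbb{R}$, let $T>0$ and $\epsilon>0$. Let $L_2(\mu)$ be the space of complex-valued square-integrable functions with respect to $\mu$, with norm $\|\cdot\|_\mu$, and let $L_2(T)$ be the space of complex-valued square-integrable functions with respect to the uniform probability measure on $[0,T]$, with norm $\|f\|_T^2=\frac1T\int_0^T|f(s)|^2\,ds$ and identity operator $\mathcal{I}_T$. Define $\mathcal{F}_\mu: L_2(T)\to L_2(\mu)$ and $\mathcal{F}_\mu^*: L_2(\mu)\to L_2(T)$ by $$[\mathcal{F}_\mu f](\xi)=\frac1T\int_0^T f(s)e^{-2\pi i s\xi}\,ds,\qquad [\mathcal{F}_\mu^*\alpha](t)=\int_{\mathbb{R}}\alpha(\xi)e^{2\pi i\xi t}\,d\mu(\xi),$$ where the second formula also defines $[\mathcal{F}_\mu^*\alpha](t)$ pointwise at every $t$. Let $\mathcal{K}_\mu=\mathcal{F}_\mu^*\mathcal{F}_\mu$ on $L_2(T)$, i.e. $$[\mathcal{K}_\mu z](t)=\int_{\mathbb{R}}e^{2\pi i\xi t}\Big[\frac1T\int_0^T z(s)e^{-2\pi i\xi s}\,ds\Big]d\mu(\xi).$$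 Define the statistical dimension and the ridge leverage function by $$s_{\mu,\epsilon}=\operatorname{tr}\big(\mathcal{K}_\mu(\mathcal{K}_\mu+\epsilon\,\mathcal{I}_T)^{-1}\big),\qquad \tau_{\mu,\epsilon}(t)=\frac1T\max_{\alpha\in L_2(\mu),\ \|\alpha\|_\mu>0}\frac{|[\mathcal{F}_\mu^*\alpha](t)|^2}{\|\mathcal{F}_\mu^*\alpha\|_T^2+\epsilon\|\alpha\|_\mu^2}.$$ **Theorem (Gap-Based Leverage Score Bound).** These quantities are well defined: $\mathcal{K}_\mu+\epsilon\,\mathcal{I}_T$ is boundedly invertible, $\mathcal{K}_\mu(\mathcal{K}_\mu+\epsilon\,\mathcal{I}_T)^{-1}$ is of trace class with real trace, and for every $t\in(0,T)$ the maximum defining $\tau_{\mu,\epsilon}(t)$ is attained. Moreover, for all $t\in(0,T)$, $$\tau_{\mu,\epsilon}(t)\le\frac{s_{\mu,\epsilon}}{\min(t,T-t)}.$$ -/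

import Mathlib

open MeasureTheory ProbabilityTheory Set

namespace FourierLeverage

noncomputable section

/-! ### Exponential integral operators between `L²` spaces -/

/-- The function `x ↦ ∫ f(y) e^{2πi c y x} dρ(y)`, defined at every point `x`. It is used with
`c = -1` (Fourier transform) and `c = 1` (inverse Fourier transform). -/
def expIntegral (c : ℝ) (ρ : Measure ℝ) (f : ℝ → ℂ) (x : ℝ) : ℂ :=
  ∫ y, f y * Complex.exp (2 * Real.pi * Complex.I * (c * y * x)) ∂ρ

theorem norm_exp_kernel (c y x : ℝ) :
    ‖Complex.exp (2 * Real.pi * Complex.I * (c * y * x))‖ = 1 := by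
  have h : (2 * Real.pi * Complex.I * (c * y * x) : ℂ)
      = ((2 * Real.pi * (c * y * x) : ℝ) : ℂ) * Complex.I := by
    push_cast; ring
  rw [h, Complex.norm_exp_ofReal_mul_I]

theorem integrable_expIntegral (c : ℝ) {ρ : Measure ℝ} {f : ℝ → ℂ} (hf : Integrable f ρ) (x : ℝ) :
    Integrable (fun y : ℝ => f y * Complex.exp (2 * Real.pi * Complex.I * (c * y * x))) ρ := by
  refine hf.mul_bdd (c := 1) ?_ (Filter.Eventually.of_forall fun y => ?_)
  · exact (Continuous.aestronglyMeasurable (by fun_prop))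
  · exact (norm_exp_kernel c y x).le

theorem continuous_expIntegral (c : ℝ) {ρ : Measure ℝ} {f : ℝ → ℂ} (hf : Integrable f ρ) :
    Continuous (expIntegral c ρ f) := by
  refine continuous_of_dominated (bound := fun y => ‖f y‖) ?_ ?_ hf.norm ?_
  · intro x
    exact (integrable_expIntegral c hf x).aestronglyMeasurable
  · intro x
    refine Filter.Eventually.of_forall fun y => ?_
    rw [norm_mul, norm_exp_kernel, mul_one]
  · refine Filter.Eventually.of_forall fun y => ?_
    fun_prop

theorem norm_expIntegral_le (c : ℝ) {ρ : Measure ℝ} (f : ℝ → ℂ) (x : ℝ) :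
    ‖expIntegral c ρ f x‖ ≤ ∫ y, ‖f y‖ ∂ρ := by
  refine (norm_integral_le_integral_norm _).trans (le_of_eq ?_)
  refine integral_congr_ae (Filter.Eventually.of_forall fun y => ?_)
  simp only [norm_mul, norm_exp_kernel, mul_one]

theorem integral_norm_le_norm {ρ : Measure ℝ} [IsZeroOrProbabilityMeasure ρ] (f : Lp ℂ 2 ρ) :
    ∫ y, ‖f y‖ ∂ρ ≤ ‖f‖ := by
  rw [integral_norm_eq_lintegral_enorm (Lp.aestronglyMeasurable f), Lp.norm_def,
    ← eLpNorm_one_eq_lintegral_enorm]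
  refine ENNReal.toReal_mono (Lp.eLpNorm_ne_top f) ?_
  rcases eq_zero_or_isProbabilityMeasure ρ with h | h
  · subst h; simp
  · exact eLpNorm_le_eLpNorm_of_exponent_le (by norm_num) (Lp.aestronglyMeasurable f)

theorem integrable_Lp_two {ρ : Measure ℝ} [IsFiniteMeasure ρ] (f : Lp ℂ 2 ρ) :
    Integrable f ρ :=
  (Lp.memLp f).integrable (by norm_num)

theorem memLp_expIntegral (c : ℝ) (ρ ν : Measure ℝ) [IsFiniteMeasure ρ] [IsFiniteMeasure ν]
    (f : Lp ℂ 2 ρ) : MemLp (expIntegral c ρ f) 2 ν :=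
  MemLp.of_bound (continuous_expIntegral c (integrable_Lp_two f)).aestronglyMeasurable
    (∫ y, ‖f y‖ ∂ρ) (Filter.Eventually.of_forall fun x => norm_expIntegral_le c f x)

/-- The bounded operator `L²(ρ) → L²(ν)` sending `f` to the class of
`x ↦ ∫ f(y) e^{2πi c y x} dρ(y)`. -/
def expOperator (c : ℝ) (ρ ν : Measure ℝ) [IsZeroOrProbabilityMeasure ρ]
    [IsZeroOrProbabilityMeasure ν] : Lp ℂ 2 ρ →L[ℂ] Lp ℂ 2 ν :=
  LinearMap.mkContinuous
    { toFun := fun f => (memLp_expIntegral c ρ ν f).toLp (expIntegral c ρ f)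
      map_add' := fun f g => by
        rw [← MemLp.toLp_add]
        refine MemLp.toLp_congr _ _ (Filter.Eventually.of_forall fun x => ?_)
        simp only [Pi.add_apply, expIntegral]
        rw [← integral_add (integrable_expIntegral c (integrable_Lp_two f) x)
          (integrable_expIntegral c (integrable_Lp_two g) x)]
        refine integral_congr_ae ?_
        filter_upwards [Lp.coeFn_add f g] with y hy
        rw [hy, Pi.add_apply, add_mul]
      map_smul' := fun a f => by
        rw [RingHom.id_apply, ← MemLp.toLp_const_smul]
        refine MemLp.toLp_congr _ _ (Filter.Eventually.of_forall fun x => ?_)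
        simp only [Pi.smul_apply, expIntegral]
        rw [← integral_smul]
        refine integral_congr_ae ?_
        filter_upwards [Lp.coeFn_smul a f] with y hy
        rw [hy, Pi.smul_apply, smul_mul_assoc] }
    1 (fun f => by
      have hC : 0 ≤ ∫ y, ‖f y‖ ∂ρ := integral_nonneg fun y => norm_nonneg _
      have h := Lp.norm_le_of_ae_bound
        (f := (memLp_expIntegral c ρ ν f).toLp (expIntegral c ρ f)) hC (by
          filter_upwards [(memLp_expIntegral c ρ ν f).coeFn_toLp] with x hx
          rw [hx]
          exact norm_expIntegral_le c f x)
      have hu : ((measureUnivNNReal ν : ℝ) ^ (2 : ENNReal).toReal⁻¹) ≤ 1 := by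
        refine Real.rpow_le_one (by positivity) ?_ (by positivity)
        have : measureUnivNNReal ν ≤ 1 := by
          rw [← ENNReal.coe_le_coe, coe_measureUnivNNReal]
          exact prob_le_one
        exact_mod_cast this
      rw [one_mul]
      exact (h.trans (mul_le_of_le_one_left hC hu)).trans (integral_norm_le_norm f))

theorem expOperator_coeFn (c : ℝ) (ρ ν : Measure ℝ) [IsZeroOrProbabilityMeasure ρ]
    [IsZeroOrProbabilityMeasure ν] (f : Lp ℂ 2 ρ) :
    expOperator c ρ ν f =ᵐ[ν] expIntegral c ρ f :=
  (memLp_expIntegral c ρ ν f).coeFn_toLp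

/-! ### The Fourier transform with respect to `μ` on `[0, T]` -/

/-- The uniform probability measure on `[0, T]`; the space `L₂(T)` is `Lp ℂ 2 (unif T)`. -/
def unif (T : ℝ) : Measure ℝ := volume[|Icc (0 : ℝ) T]

instance (T : ℝ) : IsZeroOrProbabilityMeasure (unif T) :=
  inferInstanceAs (IsZeroOrProbabilityMeasure (volume[|Icc (0 : ℝ) T]))

theorem integral_unif {T : ℝ} (hT : 0 < T) (f : ℝ → ℂ) :
    ∫ s, f s ∂(unif T) = (1 / T : ℝ) • ∫ s in (0 : ℝ)..T, f s := by
  rw [unif, ProbabilityTheory.cond, integral_smul_measure, intervalIntegral.integral_of_le hT.le,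
    integral_Icc_eq_integral_Ioc, Real.volume_Icc, sub_zero, ENNReal.toReal_inv,
    ENNReal.toReal_ofReal hT.le, one_div]

/-- `[F_μ f](ξ) = (1/T) ∫₀ᵀ f(s) e^{-2πi s ξ} ds`, as an operator `L₂(T) → L₂(μ)`. -/
def fourierOp (μ : Measure ℝ) [IsProbabilityMeasure μ] (T : ℝ) :
    Lp ℂ 2 (unif T) →L[ℂ] Lp ℂ 2 μ :=
  expOperator (-1) (unif T) μ

/-- The pointwise inverse transform `[F_μ^* α](t) = ∫ α(ξ) e^{2πi ξ t} dμ(ξ)`. -/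
def invFourier (μ : Measure ℝ) (α : ℝ → ℂ) (t : ℝ) : ℂ :=
  expIntegral 1 μ α t

/-- `F_μ^*` as an operator `L₂(μ) → L₂(T)`: the class of `t ↦ ∫ α(ξ) e^{2πi ξ t} dμ(ξ)`. -/
def invFourierOp (μ : Measure ℝ) [IsProbabilityMeasure μ] (T : ℝ) :
    Lp ℂ 2 μ →L[ℂ] Lp ℂ 2 (unif T) :=
  expOperator 1 μ (unif T)

/-- The kernel operator
`[K_μ z](t) = ∫ e^{2πi ξ t} [(1/T) ∫₀ᵀ z(s) e^{-2πi ξ s} ds] dμ(ξ)` on `L₂(T)`. -/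
def kernelOp (μ : Measure ℝ) [IsProbabilityMeasure μ] (T : ℝ) :
    Lp ℂ 2 (unif T) →L[ℂ] Lp ℂ 2 (unif T) :=
  (invFourierOp μ T).comp (fourierOp μ T)

/-- `K_μ + ε I_T`. -/
def regKernelOp (μ : Measure ℝ) [IsProbabilityMeasure μ] (T ε : ℝ) :
    Lp ℂ 2 (unif T) →L[ℂ] Lp ℂ 2 (unif T) :=
  kernelOp μ T + (ε : ℂ) • ContinuousLinearMap.id ℂ (Lp ℂ 2 (unif T))

/-! ### Trace and statistical dimension -/

/-- The bounded operator `A` is of trace class with trace `z`: in every orthonormal (Hilbert) basis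
the diagonal series of `A` converges unconditionally (equivalently, absolutely), with sum `z`. -/
def HasTrace {H : Type*} [NormedAddCommGroup H] [InnerProductSpace ℂ H] (A : H →L[ℂ] H) (z : ℂ) :
    Prop :=
  ∀ (w : Set H) (b : HilbertBasis w ℂ H), HasSum (fun i => inner ℂ (b i) (A (b i))) z

open Classical in
/-- The trace of a trace-class operator (`0` for an operator that is not of trace class). -/
def opTrace {H : Type*} [NormedAddCommGroup H] [InnerProductSpace ℂ H] (A : H →L[ℂ] H) : ℂ :=
  if h : ∃ z, HasTrace A z then h.choose else 0

/-- `K_μ (K_μ + ε I_T)⁻¹`. -/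
def resolventOp (μ : Measure ℝ) [IsProbabilityMeasure μ] (T ε : ℝ) :
    Lp ℂ 2 (unif T) →L[ℂ] Lp ℂ 2 (unif T) :=
  kernelOp μ T * Ring.inverse (regKernelOp μ T ε)

/-- The Fourier statistical dimension `s_{μ,ε} = tr (K_μ (K_μ + ε I_T)⁻¹)`. -/
def statDim (μ : Measure ℝ) [IsProbabilityMeasure μ] (T ε : ℝ) : ℝ :=
  (opTrace (resolventOp μ T ε)).re

/-! ### Ridge leverage function -/

/-- The values `|[F_μ^* α](t)|² / (‖F_μ^* α‖_T² + ε ‖α‖_μ²)` over all `α ∈ L₂(μ)` with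
`‖α‖_μ > 0`. -/
def leverageRatios (μ : Measure ℝ) [IsProbabilityMeasure μ] (T ε t : ℝ) : Set ℝ :=
  {r | ∃ α : Lp ℂ 2 μ, 0 < ‖α‖ ∧
    r = ‖invFourier μ α t‖ ^ 2 / (‖invFourierOp μ T α‖ ^ 2 + ε * ‖α‖ ^ 2)}

/-- The `ε`-ridge leverage function `τ_{μ,ε}(t)`. -/
def leverage (μ : Measure ℝ) [IsProbabilityMeasure μ] (T ε t : ℝ) : ℝ :=
  (1 / T) * sSup (leverageRatios μ T ε t)

end

end FourierLeverage

namespace FourierLeverage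

/-! ### Regularized operators on Hilbert spaces -/

section Hilbert

open ContinuousLinearMap (adjoint)
open scoped ENNReal

/-! Write `A` for the inverse transform from `L²(μ)` to `L²(T)`, choose a self-adjoint invertible
`N` with `N² = A†A + ε`, and let `φ_t` be the unit character representing evaluation at `t`.
Cauchy–Schwarz gives `T τ(t) = ‖N⁻¹φ_t‖²`, a maximum attained at `N⁻²φ_t` (`isGreatest_ratio`). The
trace is the squared Hilbert–Schmidt norm of `A N⁻¹`, which by Parseval and Tonelli is the average
of `‖N⁻¹φ_t‖²` over `[0, T]` (`hasTrace_mul_inverse_regularized`, `tsum_enorm_eq_lintegral`).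

Put `m = min(t, T - t)`. For each `x` in `[0, m]`, the window `[0, m]` translated by `t - x` stays
in `[0, T]`. So `m/T` times the ratio at `t` is at most the maximal ratio at `x` for the interval
`[0, m]` with ridge `(T/m)ε` (`leverageRatio_le_of_shift`). Averaging over `x` bounds it by the
statistical dimension of the short interval, which is at most that of `[0, T]` by operator
monotonicity (`norm_comp_inv_sq_mono`). -/

theorem countable_of_hilbertBasis {ι H : Type*} [NormedAddCommGroup H] [InnerProductSpace ℂ H]
    [SecondCountableTopology H] (b : HilbertBasis ι ℂ H) : Countable ι := by
  refine Pairwise.countable_of_isOpen_disjoint (s := fun i => Metric.ball (b i) (1 / 2)) ?_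
    (fun i => Metric.isOpen_ball) (fun i => ⟨b i, Metric.mem_ball_self (by norm_num)⟩)
  intro i j hij
  refine Metric.ball_disjoint_ball ?_
  have h : ‖b i - b j‖ ^ 2 = 2 := by
    rw [@norm_sub_sq ℂ, b.orthonormal.1 i, b.orthonormal.1 j, b.orthonormal.2 hij]
    norm_num
  rw [dist_eq_norm]
  nlinarith [norm_nonneg (b i - b j)]

variable {E G : Type*} [NormedAddCommGroup E] [InnerProductSpace ℂ E]
  [NormedAddCommGroup G] [InnerProductSpace ℂ G]

theorem tsum_enorm_inner_sq {ι : Type*} (b : HilbertBasis ι ℂ G) (x : G) :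
    ∑' i, ‖inner ℂ x (b i)‖ₑ ^ 2 = ‖x‖ₑ ^ 2 := by
  have h : HasSum (fun i => ‖inner ℂ x (b i)‖ ^ 2) (‖x‖ ^ 2) := by
    have h1 := b.hasSum_inner_mul_inner x x
    rw [← Complex.hasSum_ofReal]
    convert! h1 using 1
    · ext i
      rw [← inner_conj_symm (b i) x, Complex.mul_conj, Complex.normSq_eq_norm_sq]
    · rw [inner_self_eq_norm_sq_to_K]; norm_cast
  have h2 := h.tsum_eq ▸ ENNReal.ofReal_tsum_of_nonneg (fun i => by positivity) h.summable
  simp_rw [ENNReal.ofReal_pow (norm_nonneg _), ofReal_norm] at h2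
  exact h2.symm

variable {N : (G →L[ℂ] G)ˣ}

theorem mul_inv_apply (x : G) : (N : G →L[ℂ] G) ((↑N⁻¹ : G →L[ℂ] G) x) = x := by
  rw [← mul_apply_eq_comp, Units.mul_inv, one_apply_eq_self]

theorem inv_mul_apply (x : G) : (↑N⁻¹ : G →L[ℂ] G) ((N : G →L[ℂ] G) x) = x := by
  rw [← mul_apply_eq_comp, Units.inv_mul, one_apply_eq_self]

variable [CompleteSpace E] [CompleteSpace G]

/-- Expand both sides by Parseval and swap the double sum. Values in `ℝ≥0∞` make the swap free of
summability conditions. -/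
theorem tsum_enorm_sq_adjoint {ι κ : Type*} (b : HilbertBasis ι ℂ E) (e : HilbertBasis κ ℂ G)
    (X : E →L[ℂ] G) : ∑' i, ‖X (b i)‖ₑ ^ 2 = ∑' j, ‖(adjoint X) (e j)‖ₑ ^ 2 := by
  simp_rw [← tsum_enorm_inner_sq e, ← tsum_enorm_inner_sq b]
  rw [ENNReal.tsum_comm]
  refine tsum_congr fun j => tsum_congr fun i => ?_
  rw [ContinuousLinearMap.adjoint_inner_left, ← inner_conj_symm, RCLike.enorm_conj]

/-- `A† A + ε`. -/
noncomputable def regularized (A : G →L[ℂ] E) (ε : ℝ) : G →L[ℂ] G :=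
  adjoint A ∘L A + (ε : ℂ) • ContinuousLinearMap.id ℂ G

open scoped ComplexOrder in
theorem isStrictlyPositive_regularized (A : G →L[ℂ] E) {ε : ℝ} (hε : 0 < ε) :
    IsStrictlyPositive (regularized A ε) := by
  have h1 : (0 : G →L[ℂ] G) ≤ adjoint A ∘L A :=
    (ContinuousLinearMap.nonneg_iff_isPositive _).2
      (ContinuousLinearMap.isPositive_adjoint_comp_self A)
  have h2 : IsStrictlyPositive ((ε : ℂ) • ContinuousLinearMap.id ℂ G) := by
    refine IsStrictlyPositive.smul (by exact_mod_cast hε) ?_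
    exact isStrictlyPositive_one
  exact IsStrictlyPositive.nonneg_add h1 h2

/-- Supplies `N`; only invertibility, self-adjointness and the value of `N²` are used later, never
positivity of `N`. -/
theorem exists_sqrt_regularized (A : G →L[ℂ] E) {ε : ℝ} (hε : 0 < ε) :
    ∃ N : (G →L[ℂ] G)ˣ, IsSelfAdjoint (N : G →L[ℂ] G) ∧
      (N : G →L[ℂ] G) * N = regularized A ε := by
  obtain ⟨a, ha, hs, h⟩ :=
    (CStarAlgebra.isStrictlyPositive_iff_exists_isUnit_and_isSelfAdjoint_and_eq_mul_self).1
      (isStrictlyPositive_regularized A hε)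
  exact ⟨ha.unit, hs, h.symm⟩

variable {A : G →L[ℂ] E} {ε : ℝ}

theorem inner_inv_left (hN : IsSelfAdjoint (N : G →L[ℂ] G)) (x y : G) :
    inner ℂ ((↑N⁻¹ : G →L[ℂ] G) x) y = inner ℂ x ((↑N⁻¹ : G →L[ℂ] G) y) := by
  have h : IsSelfAdjoint (↑N⁻¹ : G →L[ℂ] G) := by
    have : star N = N := Units.ext hN
    have h2 : star N⁻¹ = N⁻¹ := by rw [star_inv, this]
    exact congrArg Units.val h2
  exact h.isSymmetric x y

theorem norm_sqrt_sq (hN : IsSelfAdjoint (N : G →L[ℂ] G))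
    (hA : (N : G →L[ℂ] G) * N = regularized A ε) (x : G) :
    ‖(N : G →L[ℂ] G) x‖ ^ 2 = ‖A x‖ ^ 2 + ε * ‖x‖ ^ 2 := by
  have h : inner ℂ ((N : G →L[ℂ] G) x) ((N : G →L[ℂ] G) x) = inner ℂ x (regularized A ε x) := by
    rw [← hA, mul_apply_eq_comp]
    exact hN.isSymmetric x _
  rw [regularized, add_apply, ContinuousLinearMap.comp_apply, inner_add_right,
    ContinuousLinearMap.adjoint_inner_right, smul_apply, inner_smul_right,
    ContinuousLinearMap.id_apply, inner_self_eq_norm_sq_to_K, inner_self_eq_norm_sq_to_K,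
    inner_self_eq_norm_sq_to_K] at h
  exact Complex.ofReal_injective (by push_cast; exact h)

theorem inner_inv_inv (hN : IsSelfAdjoint (N : G →L[ℂ] G)) (x : G) :
    inner ℂ x ((↑N⁻¹ : G →L[ℂ] G) ((↑N⁻¹ : G →L[ℂ] G) x)) =
      ((‖(↑N⁻¹ : G →L[ℂ] G) x‖ ^ 2 : ℝ) : ℂ) := by
  rw [← inner_inv_left hN, inner_self_eq_norm_sq_to_K]; norm_cast

theorem norm_inner_le_inv (hN : IsSelfAdjoint (N : G →L[ℂ] G)) (φ α : G) :
    ‖inner ℂ φ α‖ ≤ ‖(↑N⁻¹ : G →L[ℂ] G) φ‖ * ‖(N : G →L[ℂ] G) α‖ := by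
  have h := norm_inner_le_norm (𝕜 := ℂ) ((↑N⁻¹ : G →L[ℂ] G) φ) ((N : G →L[ℂ] G) α)
  rwa [inner_inv_left hN, inv_mul_apply] at h

/-- The quadratic form of the inverse regularized operator is a maximum of ratios. -/
theorem isGreatest_ratio (hε : 0 < ε) (hN : IsSelfAdjoint (N : G →L[ℂ] G))
    (hA : (N : G →L[ℂ] G) * N = regularized A ε) {φ : G} (hφ : φ ≠ 0) :
    IsGreatest {r : ℝ | ∃ α : G, 0 < ‖α‖ ∧
      r = ‖inner ℂ φ α‖ ^ 2 / (‖A α‖ ^ 2 + ε * ‖α‖ ^ 2)} (‖(↑N⁻¹ : G →L[ℂ] G) φ‖ ^ 2) := by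
  constructor
  · have h0 : (↑N⁻¹ : G →L[ℂ] G) φ ≠ 0 := fun h => hφ (by rw [← mul_inv_apply (N := N) φ, h, map_zero])
    have h1 : (↑N⁻¹ : G →L[ℂ] G) ((↑N⁻¹ : G →L[ℂ] G) φ) ≠ 0 :=
      fun h => h0 (by rw [← mul_inv_apply (N := N) ((↑N⁻¹ : G →L[ℂ] G) φ), h, map_zero])
    -- The maximizer is `N⁻²φ`, the equality case of Cauchy–Schwarz for `N⁻¹φ` and `Nα`.
    refine ⟨_, norm_pos_iff.2 h1, ?_⟩
    rw [← norm_sqrt_sq hN hA, mul_inv_apply, inner_inv_inv hN, Complex.norm_real,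
      Real.norm_of_nonneg (by positivity)]
    have := norm_pos_iff.2 h0
    field_simp
  · rintro r ⟨α, hα, rfl⟩
    rw [div_le_iff₀ (by positivity), ← norm_sqrt_sq hN hA, ← mul_pow]
    exact pow_le_pow_left₀ (norm_nonneg _) (norm_inner_le_inv hN φ α) 2

theorem norm_comp_inv_sq (hN : IsSelfAdjoint (N : G →L[ℂ] G))
    (hA : (N : G →L[ℂ] G) * N = regularized A ε) (x : G) :
    ‖A ((↑N⁻¹ : G →L[ℂ] G) x)‖ ^ 2 = ‖x‖ ^ 2 - ε * ‖(↑N⁻¹ : G →L[ℂ] G) x‖ ^ 2 := by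
  have h := norm_sqrt_sq hN hA ((↑N⁻¹ : G →L[ℂ] G) x)
  rw [mul_inv_apply] at h
  linarith

/-- Monotonicity of `A ↦ A (A† A + ε)⁻¹ A†`, up to a common rescaling `c` of `A† A` and `ε`. -/
theorem norm_comp_inv_sq_mono {E' : Type*} [NormedAddCommGroup E'] [InnerProductSpace ℂ E']
    [CompleteSpace E'] {B : G →L[ℂ] E'} {M : (G →L[ℂ] G)ˣ} {c : ℝ} (hc : 0 < c) (hε : 0 < ε)
    (hN : IsSelfAdjoint (N : G →L[ℂ] G)) (hA : (N : G →L[ℂ] G) * N = regularized A ε)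
    (hM : IsSelfAdjoint (M : G →L[ℂ] G)) (hB : (M : G →L[ℂ] G) * M = regularized B (c * ε))
    (h : ∀ x, ‖B x‖ ^ 2 ≤ c * ‖A x‖ ^ 2) (x : G) :
    ‖B ((↑M⁻¹ : G →L[ℂ] G) x)‖ ^ 2 ≤ ‖A ((↑N⁻¹ : G →L[ℂ] G) x)‖ ^ 2 := by
  -- Both sides become `‖x‖²` minus a ridge term, so the claim reduces to `p² ≤ c q²`.
  rw [norm_comp_inv_sq hN hA, norm_comp_inv_sq hM hB]
  set p := ‖(↑N⁻¹ : G →L[ℂ] G) x‖ with hp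
  set q := ‖(↑M⁻¹ : G →L[ℂ] G) x‖ with hq
  -- Test the Cauchy–Schwarz bound for `M` on the vector that is extremal for `N`.
  set y := (↑N⁻¹ : G →L[ℂ] G) ((↑N⁻¹ : G →L[ℂ] G) x) with hy
  have h1 : p ^ 2 ≤ q * ‖(M : G →L[ℂ] G) y‖ := by
    have := norm_inner_le_inv hM x y
    rwa [hy, inner_inv_inv hN, Complex.norm_real, Real.norm_of_nonneg (by positivity)] at this
  have h2 : ‖(M : G →L[ℂ] G) y‖ ^ 2 ≤ c * p ^ 2 := by
    have h3 := norm_sqrt_sq hN hA y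
    rw [hy, mul_inv_apply, ← hy] at h3
    rw [norm_sqrt_sq hM hB, hp, h3]
    nlinarith [h y]
  have h4 : p ^ 2 * p ^ 2 ≤ c * q ^ 2 * p ^ 2 := by
    calc p ^ 2 * p ^ 2 ≤ (q * ‖(M : G →L[ℂ] G) y‖) ^ 2 := by
          rw [← sq]; exact pow_le_pow_left₀ (by positivity) h1 2
      _ = q ^ 2 * ‖(M : G →L[ℂ] G) y‖ ^ 2 := mul_pow ..
      _ ≤ q ^ 2 * (c * p ^ 2) := by gcongr
      _ = _ := by ring
  have h5 : p ^ 2 ≤ c * q ^ 2 := by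
    rcases (sq_nonneg p).eq_or_lt with h0 | h0
    · rw [← h0]; positivity
    · exact le_of_mul_le_mul_right h4 h0
  nlinarith

theorem isUnit_regularized (A : G →L[ℂ] E) {ε : ℝ} (hε : 0 < ε) : IsUnit (regularized A ε) :=
  (isStrictlyPositive_regularized A hε).isUnit

/-- The diagonal of `A A† (A A† + ε)⁻¹`. -/
theorem inner_mul_inverse_regularized (hε : 0 < ε) (hN : IsSelfAdjoint (N : G →L[ℂ] G))
    (hA : (N : G →L[ℂ] G) * N = regularized A ε) (x : E) :
    inner ℂ x (((A ∘L adjoint A) * Ring.inverse (regularized (adjoint A) ε)) x) =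
      ((‖(↑N⁻¹ : G →L[ℂ] G) ((adjoint A) x)‖ ^ 2 : ℝ) : ℂ) := by
  rw [← inner_inv_inv hN, mul_apply_eq_comp, ContinuousLinearMap.comp_apply,
    ← ContinuousLinearMap.adjoint_inner_left]
  congr 1
  set y := Ring.inverse (regularized (adjoint A) ε) x with hy
  have h1 : x = regularized (adjoint A) ε y := by
    rw [hy, ← mul_apply_eq_comp, Ring.mul_inverse_cancel _ (isUnit_regularized _ hε),
      one_apply_eq_self]
  -- Push-through identity: `A†(AA† + ε) = (A†A + ε)A†`, so `N⁻²A†x = A†y`.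
  have h2 : (adjoint A) x = (N : G →L[ℂ] G) ((N : G →L[ℂ] G) ((adjoint A) y)) := by
    rw [← mul_apply_eq_comp, hA, h1]
    simp [regularized]
  rw [h2, inv_mul_apply, inv_mul_apply]

/-! ### Traces as squared Hilbert–Schmidt norms -/

theorem HasTrace.unique {H : Type*} [NormedAddCommGroup H] [InnerProductSpace ℂ H] [CompleteSpace H]
    {A : H →L[ℂ] H} {z w : ℂ} (hz : HasTrace A z) (hw : HasTrace A w) : z = w := by
  obtain ⟨s, b, -⟩ := exists_hilbertBasis ℂ H
  exact (hz s b).unique (hw s b)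

theorem HasTrace.opTrace_eq {H : Type*} [NormedAddCommGroup H] [InnerProductSpace ℂ H]
    [CompleteSpace H] {A : H →L[ℂ] H} {z : ℂ} (hz : HasTrace A z) : opTrace A = z := by
  have h : ∃ z, HasTrace A z := ⟨z, hz⟩
  rw [opTrace, dif_pos h]
  exact h.choose_spec.unique hz

theorem adjoint_inv_comp_adjoint (hN : IsSelfAdjoint (N : G →L[ℂ] G)) :
    adjoint ((↑N⁻¹ : G →L[ℂ] G) ∘L adjoint A) = A ∘L (↑N⁻¹ : G →L[ℂ] G) := by
  symm
  rw [ContinuousLinearMap.eq_adjoint_iff]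
  intro x y
  rw [ContinuousLinearMap.comp_apply, ContinuousLinearMap.comp_apply, ← inner_inv_left hN,
    ContinuousLinearMap.adjoint_inner_right]

/-- The diagonal entries are `‖N⁻¹A†b_i‖²`, and passing to the adjoint `A N⁻¹` replaces `b` by the
fixed basis `e`; hence the sum does not depend on `b`. -/
theorem hasTrace_mul_inverse_regularized (hε : 0 < ε) (hN : IsSelfAdjoint (N : G →L[ℂ] G))
    (hA : (N : G →L[ℂ] G) * N = regularized A ε) {κ : Type*} (e : HilbertBasis κ ℂ G)
    (hfin : ∑' j, ‖A ((↑N⁻¹ : G →L[ℂ] G) (e j))‖ₑ ^ 2 ≠ ∞) :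
    HasTrace ((A ∘L adjoint A) * Ring.inverse (regularized (adjoint A) ε))
      ((∑' j, ‖A ((↑N⁻¹ : G →L[ℂ] G) (e j))‖ₑ ^ 2).toReal : ℂ) := by
  intro s b
  simp_rw [inner_mul_inverse_regularized hε hN hA]
  rw [Complex.hasSum_ofReal]
  have h := tsum_enorm_sq_adjoint b e ((↑N⁻¹ : G →L[ℂ] G) ∘L adjoint A)
  rw [adjoint_inv_comp_adjoint hN] at h
  simp only [ContinuousLinearMap.comp_apply] at h
  rw [← h] at hfin ⊢
  rw [ENNReal.tsum_toReal_eq (ENNReal.ne_top_of_tsum_ne_top hfin)]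
  simpa only [ENNReal.toReal_pow, toReal_enorm] using ENNReal.hasSum_toReal hfin

end Hilbert

/-! ### The Fourier operators -/

section Fourier

open ContinuousLinearMap (adjoint)
open scoped ENNReal ComplexConjugate

theorem conj_exp_kernel (c x y : ℝ) :
    conj (Complex.exp (2 * Real.pi * Complex.I * (((-c : ℝ) : ℂ) * y * x))) =
      Complex.exp (2 * Real.pi * Complex.I * (c * x * y)) := by
  rw [← Complex.exp_conj]
  congr 1
  simp only [map_mul, Complex.conj_I, Complex.conj_ofReal, map_ofNat]
  push_cast
  ring

/-- Fubini: the kernel is unimodular, so integrability of the product `g ⊗ conj f` suffices. -/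
theorem inner_expOperator (c : ℝ) (ρ ν : Measure ℝ) [IsZeroOrProbabilityMeasure ρ]
    [IsZeroOrProbabilityMeasure ν] (f : Lp ℂ 2 ρ) (g : Lp ℂ 2 ν) :
    inner ℂ (expOperator (-c) ρ ν f) g = inner ℂ f (expOperator c ν ρ g) := by
  rw [L2.inner_def, L2.inner_def]
  have h1 : ∫ x, inner ℂ (expOperator (-c) ρ ν f x) (g x) ∂ν =
      ∫ x, ∫ y, g x * conj (f y) * Complex.exp (2 * Real.pi * Complex.I * (c * x * y)) ∂ρ ∂ν := by
    refine integral_congr_ae ?_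
    filter_upwards [expOperator_coeFn (-c) ρ ν f] with x hx
    rw [hx, RCLike.inner_apply, expIntegral, ← integral_conj, ← integral_const_mul]
    refine integral_congr_ae (Filter.Eventually.of_forall fun y => ?_)
    simp only [map_mul, conj_exp_kernel]
    ring
  have h2 : ∫ y, inner ℂ (f y) (expOperator c ν ρ g y) ∂ρ =
      ∫ y, ∫ x, g x * conj (f y) * Complex.exp (2 * Real.pi * Complex.I * (c * x * y)) ∂ν ∂ρ := by
    refine integral_congr_ae ?_
    filter_upwards [expOperator_coeFn c ν ρ g] with y hy
    rw [hy, RCLike.inner_apply, expIntegral, ← integral_mul_const]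
    refine integral_congr_ae (Filter.Eventually.of_forall fun x => ?_)
    ring
  rw [h1, h2]
  refine integral_integral_swap ?_
  have hf : Integrable (fun y => conj (f y)) ρ :=
    Complex.conjCLE.toContinuousLinearMap.integrable_comp (integrable_Lp_two f)
  refine ((integrable_Lp_two g).mul_prod hf).mul_bdd (c := 1)
    (Continuous.aestronglyMeasurable (by fun_prop)) (Filter.Eventually.of_forall fun z => ?_)
  exact (norm_exp_kernel c z.1 z.2).le

variable (μ : Measure ℝ) [IsProbabilityMeasure μ]

theorem adjoint_invFourierOp (T : ℝ) : adjoint (invFourierOp μ T) = fourierOp μ T := by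
  symm
  rw [ContinuousLinearMap.eq_adjoint_iff]
  exact inner_expOperator 1 (unif T) μ

theorem regKernelOp_eq (T ε : ℝ) :
    regKernelOp μ T ε = regularized (adjoint (invFourierOp μ T)) ε := by
  rw [regularized, ContinuousLinearMap.adjoint_adjoint, adjoint_invFourierOp, regKernelOp, kernelOp]

theorem resolventOp_eq (T ε : ℝ) :
    resolventOp μ T ε = ((invFourierOp μ T).comp (adjoint (invFourierOp μ T))) *
      Ring.inverse (regularized (adjoint (invFourierOp μ T)) ε) := by
  rw [resolventOp, regKernelOp_eq, adjoint_invFourierOp, kernelOp]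

/-- The character `ξ ↦ e^{-2πi t ξ}`, as an element of `L²(μ)`. -/
noncomputable def character (t : ℝ) : Lp ℂ 2 μ :=
  MemLp.toLp (fun ξ : ℝ => Complex.exp (2 * Real.pi * Complex.I * (((-1 : ℝ) : ℂ) * t * ξ)))
    (MemLp.of_bound (Continuous.aestronglyMeasurable (by fun_prop)) 1
      (Filter.Eventually.of_forall fun ξ => (norm_exp_kernel (-1) t ξ).le))

theorem character_coeFn (t : ℝ) : character μ t =ᵐ[μ]
    fun ξ : ℝ => Complex.exp (2 * Real.pi * Complex.I * (((-1 : ℝ) : ℂ) * t * ξ)) :=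
  MemLp.coeFn_toLp _

variable {μ}

/-- Makes evaluation at `t` a bounded functional, so the abstract ratio lemma applies to leverage.
-/
theorem inner_character (t : ℝ) (α : Lp ℂ 2 μ) : inner ℂ (character μ t) α = invFourier μ α t := by
  rw [L2.inner_def, invFourier, expIntegral]
  refine integral_congr_ae ?_
  filter_upwards [character_coeFn μ t] with ξ hξ
  rw [hξ, RCLike.inner_apply, conj_exp_kernel]

theorem norm_character (t : ℝ) : ‖character μ t‖ = 1 := by
  have h : inner ℂ (character μ t) (character μ t) = 1 := by
    have h1 : ∀ᵐ ξ ∂μ, inner ℂ (character μ t ξ) (character μ t ξ) = (1 : ℂ) := by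
      filter_upwards [character_coeFn μ t] with ξ hξ
      rw [inner_self_eq_norm_sq_to_K, hξ, norm_exp_kernel]
      simp
    rw [L2.inner_def, integral_congr_ae h1]
    simp
  rw [← sq_eq_sq₀ (norm_nonneg _) zero_le_one, ← @inner_self_eq_norm_sq ℂ, h]
  simp

theorem character_ne_zero (t : ℝ) : character μ t ≠ 0 :=
  norm_ne_zero_iff.1 (by rw [norm_character]; exact one_ne_zero)

theorem continuous_invFourier (α : Lp ℂ 2 μ) : Continuous (invFourier μ α) :=
  continuous_expIntegral 1 (integrable_Lp_two α)

theorem isProbabilityMeasure_unif {T : ℝ} (hT : 0 < T) : IsProbabilityMeasure (unif T) :=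
  cond_isProbabilityMeasure_of_finite (by simpa using hT) (by simp)

theorem enorm_invFourierOp_sq (T : ℝ) (α : Lp ℂ 2 μ) :
    ‖invFourierOp μ T α‖ₑ ^ 2 = ∫⁻ t, ‖invFourier μ α t‖ₑ ^ 2 ∂(unif T) := by
  have h := eLpNorm_nnreal_pow_eq_lintegral (f := invFourierOp μ T α) (μ := unif T)
    (p := 2) two_ne_zero
  simp only [NNReal.coe_ofNat, ENNReal.rpow_ofNat, ENNReal.coe_ofNat] at h
  rw [Lp.enorm_def, h]
  refine lintegral_congr_ae ?_
  filter_upwards [expOperator_coeFn 1 μ (unif T) α] with t ht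
  rw [invFourierOp, ht, invFourier]

theorem norm_invFourierOp_sq {T : ℝ} (hT : 0 < T) (α : Lp ℂ 2 μ) :
    ‖invFourierOp μ T α‖ ^ 2 = (1 / T) * ∫ s in (0 : ℝ)..T, ‖invFourier μ α s‖ ^ 2 := by
  have h : inner ℂ (invFourierOp μ T α) (invFourierOp μ T α) =
      ∫ s, ((‖invFourier μ α s‖ ^ 2 : ℝ) : ℂ) ∂(unif T) := by
    rw [L2.inner_def]
    refine integral_congr_ae ?_
    filter_upwards [expOperator_coeFn 1 μ (unif T) α] with t ht
    rw [inner_self_eq_norm_sq_to_K, invFourierOp, ht, invFourier]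
    norm_cast
  rw [integral_unif hT, intervalIntegral.integral_ofReal, inner_self_eq_norm_sq_to_K] at h
  refine Complex.ofReal_injective ?_
  push_cast
  rw [Complex.real_smul] at h
  push_cast at h
  exact h

/-- Modulating `α` translates its inverse transform. -/
theorem exists_invFourier_add (α : Lp ℂ 2 μ) (a : ℝ) :
    ∃ β : Lp ℂ 2 μ, ‖β‖ = ‖α‖ ∧ ∀ s, invFourier μ β s = invFourier μ α (s + a) := by
  set f : ℝ → ℂ := fun ξ => α ξ * Complex.exp (2 * Real.pi * Complex.I * ((1 : ℝ) * ξ * a)) with hf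
  have hm : AEStronglyMeasurable f μ :=
    (Lp.aestronglyMeasurable α).mul (Continuous.aestronglyMeasurable (by fun_prop))
  have hn : ∀ ξ, ‖f ξ‖ = ‖α ξ‖ := fun ξ => by rw [hf, norm_mul, norm_exp_kernel, mul_one]
  have hL : MemLp f 2 μ := (Lp.memLp α).of_le hm (Filter.Eventually.of_forall fun ξ => (hn ξ).le)
  refine ⟨hL.toLp f, ?_, fun s => ?_⟩
  · rw [Lp.norm_toLp, Lp.norm_def]
    congr 1
    exact eLpNorm_congr_norm_ae (Filter.Eventually.of_forall hn)
  · rw [invFourier, invFourier, expIntegral, expIntegral]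
    refine integral_congr_ae ?_
    filter_upwards [hL.coeFn_toLp] with ξ hξ
    rw [hξ, hf, mul_assoc, ← Complex.exp_add]
    congr 2
    push_cast
    ring

/-- The shifted window `[a, m + a]` lies in `[0, T]`; the factor `T / m` comes from the two
normalizations. -/
theorem norm_invFourierOp_sq_le_of_shift {T m a : ℝ} (hm : 0 < m) (ha : 0 ≤ a) (hT : m + a ≤ T)
    {α β : Lp ℂ 2 μ} (h : ∀ s, invFourier μ β s = invFourier μ α (s + a)) :
    ‖invFourierOp μ m β‖ ^ 2 ≤ T / m * ‖invFourierOp μ T α‖ ^ 2 := by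
  have hT0 : 0 < T := by linarith
  rw [norm_invFourierOp_sq hm, norm_invFourierOp_sq hT0]
  simp_rw [h]
  rw [intervalIntegral.integral_comp_add_right (fun s => ‖invFourier μ α s‖ ^ 2)]
  have h1 : ∫ s in (0 + a)..(m + a), ‖invFourier μ α s‖ ^ 2 ≤
      ∫ s in (0 : ℝ)..T, ‖invFourier μ α s‖ ^ 2 :=
    intervalIntegral.integral_mono_interval (by linarith) (by linarith) hT
      (Filter.Eventually.of_forall fun s => sq_nonneg _)
      (((continuous_invFourier α).norm.pow 2).intervalIntegrable _ _)
  calc 1 / m * ∫ s in (0 + a)..(m + a), ‖invFourier μ α s‖ ^ 2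
      ≤ 1 / m * ∫ s in (0 : ℝ)..T, ‖invFourier μ α s‖ ^ 2 := by gcongr
    _ = _ := by field_simp

/-! ### Leverage and statistical dimension -/

section Sqrt

variable {T ε : ℝ} {N : (Lp ℂ 2 μ →L[ℂ] Lp ℂ 2 μ)ˣ}

theorem isGreatest_leverageRatios (hε : 0 < ε) (hN : IsSelfAdjoint (N : Lp ℂ 2 μ →L[ℂ] Lp ℂ 2 μ))
    (hA : (N : Lp ℂ 2 μ →L[ℂ] Lp ℂ 2 μ) * N = regularized (invFourierOp μ T) ε) (t : ℝ) :
    IsGreatest (leverageRatios μ T ε t)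
      (‖(↑N⁻¹ : Lp ℂ 2 μ →L[ℂ] Lp ℂ 2 μ) (character μ t)‖ ^ 2) := by
  have h := isGreatest_ratio hε hN hA (character_ne_zero (μ := μ) t)
  simp_rw [inner_character] at h
  exact h

/-- Tonelli, then Parseval at each `t` for `N⁻¹φ_t`. Separability of `L²(μ)` makes the basis
countable, as the interchange requires. -/
theorem tsum_enorm_eq_lintegral (hN : IsSelfAdjoint (N : Lp ℂ 2 μ →L[ℂ] Lp ℂ 2 μ)) {κ : Type*}
    (e : HilbertBasis κ ℂ (Lp ℂ 2 μ)) :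
    ∑' j, ‖invFourierOp μ T ((↑N⁻¹ : Lp ℂ 2 μ →L[ℂ] Lp ℂ 2 μ) (e j))‖ₑ ^ 2 =
      ∫⁻ t, ‖(↑N⁻¹ : Lp ℂ 2 μ →L[ℂ] Lp ℂ 2 μ) (character μ t)‖ₑ ^ 2 ∂(unif T) := by
  have : Fact ((2 : ℝ≥0∞) ≠ ∞) := ⟨by norm_num⟩
  have := countable_of_hilbertBasis e
  simp_rw [enorm_invFourierOp_sq]
  rw [← lintegral_tsum fun j =>
    ((continuous_invFourier _).measurable.enorm.pow_const 2).aemeasurable]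
  refine lintegral_congr fun t => ?_
  rw [← tsum_enorm_inner_sq e]
  refine tsum_congr fun j => ?_
  rw [inner_inv_left hN, inner_character]

/-- Characters are unit vectors, so the integrand is at most `‖N⁻¹‖²`; this is what gives trace
class. -/
theorem lintegral_enorm_inv_character_ne_top :
    ∫⁻ t, ‖(↑N⁻¹ : Lp ℂ 2 μ →L[ℂ] Lp ℂ 2 μ) (character μ t)‖ₑ ^ 2 ∂(unif T) ≠ ∞ := by
  refine ne_top_of_le_ne_top ?_
    (lintegral_mono (g := fun _ => ‖(↑N⁻¹ : Lp ℂ 2 μ →L[ℂ] Lp ℂ 2 μ)‖ₑ ^ 2) fun t => ?_)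
  · rw [lintegral_const]
    exact ENNReal.mul_ne_top (by simp) (measure_ne_top _ _)
  · have h := (↑N⁻¹ : Lp ℂ 2 μ →L[ℂ] Lp ℂ 2 μ).le_opNorm (character μ t)
    rw [norm_character, mul_one] at h
    exact pow_le_pow_left' (enorm_le_iff_norm_le.2 h) 2

theorem hasTrace_resolventOp (hε : 0 < ε) (hN : IsSelfAdjoint (N : Lp ℂ 2 μ →L[ℂ] Lp ℂ 2 μ))
    (hA : (N : Lp ℂ 2 μ →L[ℂ] Lp ℂ 2 μ) * N = regularized (invFourierOp μ T) ε) {κ : Type*}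
    (e : HilbertBasis κ ℂ (Lp ℂ 2 μ)) :
    HasTrace (resolventOp μ T ε)
      ((∑' j, ‖invFourierOp μ T ((↑N⁻¹ : Lp ℂ 2 μ →L[ℂ] Lp ℂ 2 μ) (e j))‖ₑ ^ 2).toReal : ℂ) := by
  rw [resolventOp_eq]
  refine hasTrace_mul_inverse_regularized hε hN hA e ?_
  rw [tsum_enorm_eq_lintegral hN]
  exact lintegral_enorm_inv_character_ne_top

end Sqrt

variable (μ)

theorem hasTrace_statDim (T : ℝ) {ε : ℝ} (hε : 0 < ε) :
    HasTrace (resolventOp μ T ε) (statDim μ T ε : ℂ) := by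
  obtain ⟨N, hN, hA⟩ := exists_sqrt_regularized (invFourierOp μ T) hε
  obtain ⟨w, e, -⟩ := exists_hilbertBasis ℂ (Lp ℂ 2 μ)
  have h := hasTrace_resolventOp hε hN hA e
  rwa [statDim, h.opTrace_eq, Complex.ofReal_re]

variable {μ}

theorem ofReal_statDim {T ε : ℝ} {N : (Lp ℂ 2 μ →L[ℂ] Lp ℂ 2 μ)ˣ} (hε : 0 < ε)
    (hN : IsSelfAdjoint (N : Lp ℂ 2 μ →L[ℂ] Lp ℂ 2 μ))
    (hA : (N : Lp ℂ 2 μ →L[ℂ] Lp ℂ 2 μ) * N = regularized (invFourierOp μ T) ε) {κ : Type*}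
    (e : HilbertBasis κ ℂ (Lp ℂ 2 μ)) :
    ENNReal.ofReal (statDim μ T ε) =
      ∑' j, ‖invFourierOp μ T ((↑N⁻¹ : Lp ℂ 2 μ →L[ℂ] Lp ℂ 2 μ) (e j))‖ₑ ^ 2 := by
  rw [statDim, (hasTrace_resolventOp hε hN hA e).opTrace_eq, Complex.ofReal_re,
    ENNReal.ofReal_toReal]
  rw [tsum_enorm_eq_lintegral hN]
  exact lintegral_enorm_inv_character_ne_top

/-- The part of the statistical dimension carried by a subinterval of length `m`. -/
theorem lintegral_enorm_inv_character_le_statDim {T m ε : ℝ} (hm : 0 < m) (hmT : m ≤ T)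
    (hε : 0 < ε) {M : (Lp ℂ 2 μ →L[ℂ] Lp ℂ 2 μ)ˣ}
    (hM : IsSelfAdjoint (M : Lp ℂ 2 μ →L[ℂ] Lp ℂ 2 μ))
    (hB : (M : Lp ℂ 2 μ →L[ℂ] Lp ℂ 2 μ) * M = regularized (invFourierOp μ m) (T / m * ε)) :
    ∫⁻ t, ‖(↑M⁻¹ : Lp ℂ 2 μ →L[ℂ] Lp ℂ 2 μ) (character μ t)‖ₑ ^ 2 ∂(unif m) ≤
      ENNReal.ofReal (statDim μ T ε) := by
  obtain ⟨N, hN, hA⟩ := exists_sqrt_regularized (invFourierOp μ T) hε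
  obtain ⟨w, e, -⟩ := exists_hilbertBasis ℂ (Lp ℂ 2 μ)
  rw [ofReal_statDim hε hN hA e, ← tsum_enorm_eq_lintegral hM e]
  refine ENNReal.tsum_le_tsum fun j => ?_
  -- Zero shift is restriction to `[0, m]`, giving `A_m†A_m ≤ (T/m) A_T†A_T`; the ridge is scaled by
  -- the same factor.
  have h := norm_comp_inv_sq_mono (c := T / m) (div_pos (by linarith) hm) hε hN hA hM hB
    (fun α => norm_invFourierOp_sq_le_of_shift (a := 0) hm le_rfl (by linarith) (by simp)) (e j)
  exact pow_le_pow_left' (enorm_le_iff_norm_le.2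
    ((sq_le_sq₀ (norm_nonneg _) (norm_nonneg _)).1 h)) 2

/-- Modulating the maximizer at `t` moves its value there to `x` and keeps its norm, while the
energy on `[0, m]` is at most `T / m` times the energy on `[0, T]`. -/
theorem leverageRatio_le_of_shift {T m ε t x : ℝ} (hm : 0 < m) (hε : 0 < ε) (hxt : x ≤ t)
    (hT : m + (t - x) ≤ T) {r q : ℝ} (hr : IsGreatest (leverageRatios μ T ε t) r)
    (hq : IsGreatest (leverageRatios μ m (T / m * ε) x) q) : m / T * r ≤ q := by
  have hT0 : 0 < T := by linarith
  obtain ⟨α, hα, rfl⟩ := hr.1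
  obtain ⟨β, hβ, h⟩ := exists_invFourier_add α (t - x)
  have h1 := norm_invFourierOp_sq_le_of_shift hm (sub_nonneg.2 hxt) hT h
  refine le_trans ?_ (hq.2 ⟨β, hβ ▸ hα, rfl⟩)
  rw [h x, hβ, add_sub_cancel]
  have h2 : m / T * (‖invFourier μ α t‖ ^ 2 / (‖invFourierOp μ T α‖ ^ 2 + ε * ‖α‖ ^ 2)) =
      ‖invFourier μ α t‖ ^ 2 /
        (T / m * ‖invFourierOp μ T α‖ ^ 2 + T / m * ε * ‖α‖ ^ 2) := by
    field_simp
  rw [h2]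
  gcongr

theorem statDim_nonneg (T : ℝ) {ε : ℝ} (hε : 0 < ε) : 0 ≤ statDim μ T ε := by
  obtain ⟨N, hN, hA⟩ := exists_sqrt_regularized (invFourierOp μ T) hε
  obtain ⟨w, e, -⟩ := exists_hilbertBasis ℂ (Lp ℂ 2 μ)
  rw [statDim, (hasTrace_resolventOp hε hN hA e).opTrace_eq, Complex.ofReal_re]
  exact ENNReal.toReal_nonneg

theorem leverage_le_statDim_div {T ε t : ℝ} (hε : 0 < ε) (ht : t ∈ Ioo 0 T) :
    leverage μ T ε t ≤ statDim μ T ε / min t (T - t) := by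
  obtain ⟨ht0, htT⟩ := ht
  have hT : 0 < T := ht0.trans htT
  set m := min t (T - t) with hmdef
  have hm : 0 < m := lt_min ht0 (sub_pos.2 htT)
  have hmt : m ≤ t := min_le_left _ _
  have hmT : m ≤ T - t := min_le_right _ _
  obtain ⟨N, hN, hA⟩ := exists_sqrt_regularized (invFourierOp μ T) hε
  obtain ⟨M, hM, hB⟩ := exists_sqrt_regularized (invFourierOp μ m)
    (mul_pos (div_pos hT hm) hε)
  have hr := isGreatest_leverageRatios hε hN hA t
  rw [leverage, hr.csSup_eq]
  set r := ‖(↑N⁻¹ : Lp ℂ 2 μ →L[ℂ] Lp ℂ 2 μ) (character μ t)‖ ^ 2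
  have := isProbabilityMeasure_unif hm
  have h1 : ENNReal.ofReal (m / T * r) ≤ ENNReal.ofReal (statDim μ T ε) := by
    refine le_trans ?_ (lintegral_enorm_inv_character_le_statDim hm (by linarith) hε hM hB)
    -- Write the constant as its own average over `[0, m]`, to be compared pointwise in `x`.
    rw [← mul_one (ENNReal.ofReal _), ← measure_univ (μ := unif m), ← lintegral_const]
    refine lintegral_mono_ae ?_
    have hmem : ∀ᵐ x ∂(unif m), x ∈ Icc 0 m := ae_cond_mem measurableSet_Icc
    filter_upwards [hmem] with x hx
    rw [← ofReal_norm, ← ENNReal.ofReal_pow (norm_nonneg _)]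
    -- Both halves of the minimum enter: `x ≤ m ≤ t` makes the shift nonnegative, and `m ≤ T - t`
    -- with `x ≥ 0` keeps the window inside `[0, T]`.
    exact ENNReal.ofReal_le_ofReal (leverageRatio_le_of_shift hm hε (hx.2.trans hmt)
      (by linarith [hx.1]) hr (isGreatest_leverageRatios (by positivity) hM hB x))
  rw [ENNReal.ofReal_le_ofReal_iff (statDim_nonneg T hε)] at h1
  rw [le_div_iff₀ hm]
  calc 1 / T * r * m = m / T * r := by ring
    _ ≤ _ := h1

end Fourier

end FourierLeverage

theorem mainTheorem6 (μ : MeasureTheory.Measure ℝ) [MeasureTheory.IsProbabilityMeasure μ]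
    (T ε : ℝ) (hT : 0 < T) (hε : 0 < ε) :
    (IsUnit (FourierLeverage.regKernelOp μ T ε) ∧
      FourierLeverage.HasTrace (FourierLeverage.resolventOp μ T ε)
        (FourierLeverage.statDim μ T ε : ℂ)) ∧
    ∀ t ∈ Set.Ioo 0 T,
      (∃ r, IsGreatest (FourierLeverage.leverageRatios μ T ε t) r) ∧
      FourierLeverage.leverage μ T ε t ≤ FourierLeverage.statDim μ T ε / min t (T - t) := by
  refine ⟨⟨?_, FourierLeverage.hasTrace_statDim μ T hε⟩, fun t ht =>
    ⟨?_, FourierLeverage.leverage_le_statDim_div hε ht⟩⟩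
  · rw [FourierLeverage.regKernelOp_eq]
    exact FourierLeverage.isUnit_regularized _ hε
  · obtain ⟨N, hN, hA⟩ :=
      FourierLeverage.exists_sqrt_regularized (FourierLeverage.invFourierOp μ T) hε
    exact ⟨_, FourierLeverage.isGreatest_leverageRatios hε hN hA t⟩
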